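/- **Theorem (Master tail bound for independent sums of random T-product tensors, eigentuple version).** *Notation.* Let $m,p\ge 1$. For a tensor $\mathcal C\in\mathbb C^{m\times n\times p}$ with frontal slices $\mathbf C^{(1)},\dots,\mathbf C^{(p)}$ let $\mathrm{bcirc}(\mathcal C)$ be the block circulant matrix whose block in position $(k,l)$ is $\mathbf C^{(k-l+1)}$ (upper indices modulo $p$), let $\mathrm{unfold}(\mathcal C)$ be the matrix of the frontal slices stacked on top of each other, and let $\mathrm{fold}$ be the inverse of $\mathrm{unfold}$. The T-product is $\mathcal C\star\mathcal D=\mathrm{fold}(\mathrm{bcirc}(\mathcal C)\,\mathrm{unfold}(\mathcal D))$. The Hermitian transpose $\mathcal C^{\mathrm H}$ is defined by $\mathrm{bcirc}(\mathcal C^{\mathrm H})=\mathrm{bcirc}(\mathcal C)^{\mathrm H}$, the identity tensor $\mathcal I$ by $\mathrm{bcirc}(\mathcal I)=\mathbf I_{mp}$, and $\mathcal C\in\mathbb C^{m\times m\times p}$ is Hermitian if $\mathcal C^{\mathrm H}=\mathcal C$. For $\mathcal C=(c_{ijk})\in\mathbb C^{m\times m\times p}$ put $\mathrm{Tr}(\mathcal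 C)=\sum_{i=1}^m\sum_{k=1}^p c_{iik}$ and $e^{\mathcal C}=\exp(\mathcal C)=\sum_{k\ge0}\mathcal C^k/k!$ (powers for $\star$, $\mathcal C^0=\mathcal I$). For $\mathcal C$ with $\mathrm{bcirc}(\mathcal C)$ positive definite, $\log\mathcal C$ is the Hermitian tensor with $e^{\log\mathcal C}=\mathcal C$. For Hermitian $\mathcal C$, $\lambda_{\max}(\mathcal C)$ is the largest eigenvalue of $\mathcal C$, i.e. the largest real $\lambda$ with $\mathcal C\star\mathcal X=\lambda\mathcal X$ for some nonzero $\mathcal X\in\mathbb C^{m\times1\times p}$. Inequalities between vectors of $\mathbb R^p$ are entrywise. A maximum eigentuple $\mathbf d_{\max}(\mathcal C)$ of a Hermitian tensor $\mathcal C$ is the first diagonal tube $\mathbf s_1\in\mathbb R^p$ of $\mathcal S$ in a decomposition $\mathcal C=\mathcal U\star\mathcal S\star\mathcal U^{\mathrm H}$ with $\mathcal U^{\mathrm H}\star\mathcal U=\mathcal U\star\mathcal U^{\mathrm H}=\mathcal I$ and $\mathcal S$ an f-diagonal tensor (all frontal slices diagonal) in standard form, that is, with real diagonal tubes $\mathbf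 s_1\ge\mathbf s_2\ge\dots\ge\mathbf s_m$. The event $\{\mathbf d_{\max}(\mathcal C)\ge\mathbf b\}$ means that $\mathcal C$ has such a maximum eigentuple that is $\ge\mathbf b$. For $\mathbf a,\mathbf b\in\mathbb R^p$ put $\mathbf a\odot\mathbf b=\mathrm{circ}(\mathbf a)\,\mathbf b$, where $\mathrm{circ}(\mathbf a)$ is the circulant matrix with first column $\mathbf a$, and $e_\odot^{\mathbf a}=\sum_{k\ge0}\mathbf a^{\odot k}/k!$ with $\mathbf a^{\odot0}=(1,0,\dots,0)^{\mathrm T}$. *Statement.* Let $\mathcal X_1,\dots,\mathcal X_n\in\mathbb C^{m\times m\times p}$ be independent random Hermitian tensors and let $\mathbf b\in\mathbb R^p$. Let $T\subseteq(0,\infty)$ be a set such that, for every $t\in T$, each $e^{t\mathcal X_i}$ is integrable, all entries of $e_\odot^{t\mathbf b}$ are nonnegative, and $$\frac1p\,\lambda_{\max}^{p}\Big(e^{\sum_{i=1}^n t\mathcal X_i}\Big)+1-\frac1p\ \le\ \mathrm{Tr}\Big(e^{\sum_{i=1}^n t\mathcal X_i}\Big)\qquad\text{almost surely.}$$ Then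 $$\Pr\Big(\mathbf d_{\max}\Big(\sum_{i=1}^n\mathcal X_i\Big)\ge\mathbf b\Big)\ \le\ \inf_{t\in T}\ \min_{1\le j\le p}\ \frac{\mathrm{Tr}\exp\big(\sum_{i=1}^n\log\mathbb E\,e^{t\mathcal X_i}\big)}{\big(e_\odot^{t\mathbf b}\big)_j},$$ where a quotient with denominator $0$ is read as $+\infty$. (If the assumptions hold for every $t>0$, one may take $T=(0,\infty)$. If the event is not measurable, $\Pr$ denotes outer probability.) -/

import Mathlib

open MeasureTheory ProbabilityTheory

noncomputable section

namespace TProduct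

/-- Third order tensors `C = (c i j k)` of size `m × n × p` over `ℂ`; the `k`-th frontal slice is
the matrix `fun i j => C i j k`. Indices start at `0`, and index arithmetic in `Fin p` is modulo
`p`. -/
abbrev Tensor (m n p : ℕ) : Type := Fin m → Fin n → Fin p → ℂ

variable {m n q p : ℕ}

/-- The block circulant matrix of a tensor: the block in position `(k, l)` is the frontal slice
with index `k - l` modulo `p`. -/
def bcirc (C : Tensor m n p) : Matrix (Fin p × Fin m) (Fin p × Fin n) ℂ :=
  Matrix.of fun a b => C a.2 b.2 (a.1 - b.1)

/-- The inverse of `bcirc` (a block circulant matrix is determined by its first block column). -/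
def bcircInv [NeZero p] (M : Matrix (Fin p × Fin m) (Fin p × Fin n) ℂ) : Tensor m n p :=
  fun i j k => M (k, i) (0, j)

theorem bcircInv_bcirc [NeZero p] (C : Tensor m n p) : bcircInv (bcirc C) = C := by
  funext i j k
  simp [bcircInv, bcirc]

/-- The frontal slices stacked on top of each other. -/
def unfold (C : Tensor m n p) : Matrix (Fin p × Fin m) (Fin n) ℂ :=
  Matrix.of fun a j => C a.2 j a.1

/-- The inverse of `unfold`. -/
def fold (M : Matrix (Fin p × Fin m) (Fin n) ℂ) : Tensor m n p :=
  fun i j k => M (k, i) j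

/-- The T-product `C ⋆ D = fold (bcirc C · unfold D)`. -/
def tmul (C : Tensor m n p) (D : Tensor n q p) : Tensor m q p :=
  fold (bcirc C * unfold D)

/-- The Hermitian transpose of a tensor. -/
def hermTranspose [NeZero p] (C : Tensor m n p) : Tensor n m p :=
  bcircInv (bcirc C).conjTranspose

/-- Hermitian T-product tensors. -/
def IsHermitian [NeZero p] (C : Tensor m m p) : Prop :=
  hermTranspose C = C

/-- The identity tensor. -/
def identity (m p : ℕ) [NeZero p] : Tensor m m p :=
  bcircInv 1

/-- Powers with respect to the T-product. -/
def tpow [NeZero p] (C : Tensor m m p) : ℕ → Tensor m m p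
  | 0 => identity m p
  | k + 1 => tmul (tpow C k) C

/-- The tensor exponential `∑ k, C ^ k / k!`. -/
def texp [NeZero p] (C : Tensor m m p) : Tensor m m p :=
  ∑' k : ℕ, ((k.factorial : ℂ)⁻¹) • tpow C k

/-- The logarithm of a T-positive definite tensor, by functional calculus: the Hermitian tensor
whose block circulant matrix is the (Hermitian) logarithm of the block circulant matrix of `C`. -/
def tlog [NeZero p] (C : Tensor m m p) : Tensor m m p :=
  bcircInv (cfc Real.log (bcirc C))

/-- The T-product trace: the sum of the diagonal entries of all frontal slices. -/
def ttrace (C : Tensor m m p) : ℂ :=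
  ∑ i, ∑ k, C i i k

/-- `l` is a (real) eigenvalue of `C`: `C ⋆ X = l X` for some nonzero `m × p` matrix `X`, regarded
as an `m × 1 × p` tensor. -/
def IsEigenvalue (C : Tensor m m p) (l : ℝ) : Prop :=
  ∃ X : Tensor m 1 p, X ≠ 0 ∧ tmul C X = (l : ℂ) • X

/-- The largest eigenvalue of a Hermitian tensor. -/
def lambdaMax (C : Tensor m m p) : ℝ :=
  sSup {l : ℝ | IsEigenvalue C l}

/-- The f-diagonal tensor with the real vectors `s 0, s 1, …` as its diagonal tubes. -/
def fdiag (s : Fin m → Fin p → ℝ) : Tensor m m p :=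
  fun i j k => if i = j then (s i k : ℂ) else 0

/-- `d` is the maximum eigentuple of `C`: there is an eigendecomposition `C = U ⋆ S ⋆ Uᴴ` with `U`
unitary and `S` f-diagonal in standard form, meaning that the eigentuples `s 0 ≥ s 1 ≥ ⋯` on the
diagonal of `S` decrease for the entrywise order, and `d` is the first one, `s 0`. -/
def IsMaxEigentuple [NeZero m] [NeZero p] (C : Tensor m m p) (d : Fin p → ℝ) : Prop :=
  ∃ (U : Tensor m m p) (s : Fin m → Fin p → ℝ),
    tmul (hermTranspose U) U = identity m p ∧
    tmul U (hermTranspose U) = identity m p ∧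
    Antitone s ∧
    C = tmul (tmul U (fdiag s)) (hermTranspose U) ∧
    s 0 = d

/-- The product `a ⊙ b = circ(a) b` of vectors, with `circ(a)` the circulant matrix whose first
column is `a`. -/
def circProd (a b : Fin p → ℝ) : Fin p → ℝ :=
  (Matrix.circulant a).mulVec b

/-- Powers with respect to `⊙`; the unit is `(1, 0, …, 0)`. -/
def circPow [NeZero p] (a : Fin p → ℝ) : ℕ → Fin p → ℝ
  | 0 => Pi.single 0 1
  | k + 1 => circProd (circPow a k) a

/-- The exponential of a vector with respect to `⊙`. -/
def circExp [NeZero p] (a : Fin p → ℝ) : Fin p → ℝ :=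
  ∑' k : ℕ, ((k.factorial : ℝ)⁻¹) • circPow a k

end TProduct

end

/-!
Summing the frontal slices of a tensor is a `*`-homomorphism `sliceSum` from `m × m × p` tensors
with the T-product to `m × m` matrices, and `ttrace` is the matrix trace composed with it. It
commutes with `texp` (`sliceSum_texp`) and with `tlog` (`sliceSum_tlog`), so the bound reduces to a
statement about random Hermitian matrices.

Pointwise part. If `S` has maximum eigentuple `d ≥ b`, then `exp (t ∑ d)` is an eigenvalue of the
positive definite matrix `sliceSum (texp (t • S))`, so `Tr exp (t S) ≥ exp (t ∑ d) ≥ exp (t ∑ b)`.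
The last number is the sum of the entries of `circExp (t • b)`, since summing the entries is
multiplicative for `⊙`; as these entries are nonnegative, each of them is at most `Tr exp (t S)`
(`IsMaxEigentuple.circExp_le_ttrace_texp`). By Markov's inequality it remains to bound
`𝔼 Tr exp (t S)`.

Averaged part. The inequality `𝔼 tr exp (∑ Yᵢ) ≤ tr exp (∑ log 𝔼 exp Yᵢ)` for independent random
Hermitian matrices (`lintegral_trace_exp_add_sum_le`) follows by integrating out one summand at a
time, using Jensen's inequality for `A ↦ tr exp (H + log A)`, which is concave by Lieb's theorem
(`Matrix.concaveOn_traceExpAddLog`).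

Lieb's theorem is deduced from the joint convexity of the quantum relative entropy
`tr X log X - tr X log A` (`Matrix.PosDef.negRelEntropy_add_smul_ge`) through the Gibbs variational
formula, whose nontrivial half is Klein's inequality. In the eigenbases of `X` and `A`, the relative
entropy is a weighted sum of the numbers `x (log x - log a)`. Writing these as integrals over
`s ∈ [0, 1]` leaves the functions `⟨X, T⁻¹ X⟩` with `T Y = (1 - s) X Y + s Y A`, which are suprema
over `W` of the functions `2 Re ⟨W, X⟩ - ⟨W, T W⟩`, linear in `(X, A)`, hence jointly convex.
-/

/-! ### An integral representation of the logarithm -/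

lemma Real.one_sub_mul_add_mul_pos {x a s : ℝ} (hx : 0 < x) (ha : 0 < a) (hs0 : 0 ≤ s)
    (hs1 : s ≤ 1) : 0 < (1 - s) * x + s * a := by
  rcases hs0.eq_or_lt with rfl | h
  · simpa using hx
  · have := mul_nonneg (sub_nonneg.2 hs1) hx.le
    positivity

/-- An integral representation of `x (log a - log x)` over a bounded interval. Up to the factor
`s⁻¹`, its integrand is `x - x ^ 2 / ((1 - s) * x + s * a)`, a jointly concave function. -/
lemma Real.intervalIntegral_mul_sub_div {x a : ℝ} (hx : 0 < x) (ha : 0 < a) :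
    IntervalIntegrable (fun s => x * (a - x) / ((1 - s) * x + s * a)) volume 0 1 ∧
    ∫ s in (0 : ℝ)..1, x * (a - x) / ((1 - s) * x + s * a) =
      x * (Real.log a - Real.log x) := by
  have hT : ∀ s ∈ Set.uIcc (0 : ℝ) 1, 0 < (1 - s) * x + s * a := by
    intro s hs
    rw [Set.uIcc_of_le zero_le_one] at hs
    exact Real.one_sub_mul_add_mul_pos hx ha hs.1 hs.2
  have hint : IntervalIntegrable (fun s => x * (a - x) / ((1 - s) * x + s * a)) volume 0 1 := by
    refine ContinuousOn.intervalIntegrable ?_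
    exact ContinuousOn.div (by fun_prop) (by fun_prop) fun s hs => (hT s hs).ne'
  refine ⟨hint, ?_⟩
  have hd : ∀ s ∈ Set.uIcc (0 : ℝ) 1, HasDerivAt
      (fun s => x * Real.log ((1 - s) * x + s * a)) (x * (a - x) / ((1 - s) * x + s * a)) s := by
    intro s hs
    have h1 : HasDerivAt (fun s : ℝ => (1 - s) * x + s * a) (a - x) s := by
      have := (((hasDerivAt_id s).const_sub 1).mul_const x).add ((hasDerivAt_id s).mul_const a)
      exact this.congr_deriv (by simp; ring)
    have := (h1.log (hT s hs).ne').const_mul x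
    rwa [← mul_div_assoc] at this
  rw [intervalIntegral.integral_eq_sub_of_hasDerivAt hd hint]
  simp
  ring

/-! ### Relative entropy of matrices -/

namespace Matrix

open scoped ComplexOrder

variable {ι : Type*} [Fintype ι] [DecidableEq ι]

lemma IsHermitian.cfc_eq_conj {X : Matrix ι ι ℂ} (hX : X.IsHermitian) (f : ℝ → ℝ) :
    cfc f X = (hX.eigenvectorUnitary : Matrix ι ι ℂ) *
      diagonal (fun i => (f (hX.eigenvalues i) : ℂ)) *
        (hX.eigenvectorUnitary : Matrix ι ι ℂ)ᴴ := by
  rw [hX.cfc_eq, IsHermitian.cfc, Unitary.conjStarAlgAut_apply]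
  rfl

/-- The change of basis matrix from the eigenbasis of `A` to that of `X`. -/
noncomputable def IsHermitian.overlap {X A : Matrix ι ι ℂ} (hX : X.IsHermitian)
    (hA : A.IsHermitian) : Matrix ι ι ℂ :=
  (hX.eigenvectorUnitary : Matrix ι ι ℂ)ᴴ * (hA.eigenvectorUnitary : Matrix ι ι ℂ)

lemma IsHermitian.conjTranspose_eigenvectorUnitary_mul {X : Matrix ι ι ℂ} (hX : X.IsHermitian) :
    (hX.eigenvectorUnitary : Matrix ι ι ℂ)ᴴ * (hX.eigenvectorUnitary : Matrix ι ι ℂ) = 1 :=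
  Unitary.coe_star_mul_self hX.eigenvectorUnitary

lemma IsHermitian.eigenvectorUnitary_mul_conjTranspose {X : Matrix ι ι ℂ} (hX : X.IsHermitian) :
    (hX.eigenvectorUnitary : Matrix ι ι ℂ) * (hX.eigenvectorUnitary : Matrix ι ι ℂ)ᴴ = 1 :=
  Unitary.coe_mul_star_self hX.eigenvectorUnitary

/-- In the two eigenbases, `tr (f(X) g(A))` is a sum with nonnegative weights. This reduces trace
inequalities for two noncommuting Hermitian matrices to inequalities between real numbers. -/
lemma IsHermitian.re_trace_cfc_mul_cfc {X A : Matrix ι ι ℂ} (hX : X.IsHermitian)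
    (hA : A.IsHermitian) (f g : ℝ → ℝ) :
    (cfc f X * cfc g A).trace.re =
      ∑ i, ∑ j, ‖hX.overlap hA i j‖ ^ 2 * (f (hX.eigenvalues i) * g (hA.eigenvalues j)) := by
  set U := (hX.eigenvectorUnitary : Matrix ι ι ℂ) with hU
  set V := (hA.eigenvectorUnitary : Matrix ι ι ℂ) with hV
  have hO : hX.overlap hA = Uᴴ * V := rfl
  have h : (cfc f X * cfc g A).trace =
      ((diagonal (fun i => (f (hX.eigenvalues i) : ℂ)) * (Uᴴ * V)) *
        (diagonal (fun i => (g (hA.eigenvalues i) : ℂ)) * (Uᴴ * V)ᴴ)).trace := by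
    rw [hX.cfc_eq_conj, hA.cfc_eq_conj, ← hU, ← hV, conjTranspose_mul, conjTranspose_conjTranspose,
      mul_assoc, mul_assoc, trace_mul_comm]
    simp only [mul_assoc]
  rw [h, ← hO, trace, Complex.re_sum]
  refine Finset.sum_congr rfl fun i _ => ?_
  rw [diag_apply, mul_apply, Complex.re_sum]
  refine Finset.sum_congr rfl fun j _ => ?_
  rw [diagonal_mul, diagonal_mul, conjTranspose_apply, ← Complex.normSq_eq_norm_sq,
    Complex.star_def]
  have : (f (hX.eigenvalues i) : ℂ) * hX.overlap hA i j *
      ((g (hA.eigenvalues j) : ℂ) * (starRingEnd ℂ) (hX.overlap hA i j)) =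
      ((Complex.normSq (hX.overlap hA i j) *
        (f (hX.eigenvalues i) * g (hA.eigenvalues j)) : ℝ) : ℂ) := by
    push_cast
    rw [← Complex.mul_conj]
    ring
  rw [this, Complex.ofReal_re]

lemma IsHermitian.cfc_id {X : Matrix ι ι ℂ} (hX : X.IsHermitian) : cfc (fun x : ℝ => x) X = X :=
  _root_.cfc_id' ℝ X hX

lemma IsHermitian.cfc_one {X : Matrix ι ι ℂ} (hX : X.IsHermitian) :
    cfc (fun _ : ℝ => 1) X = 1 :=
  cfc_const_one ℝ X hX

lemma cfc_mul_matrix (f g : ℝ → ℝ) (X : Matrix ι ι ℂ) :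
    cfc f X * cfc g X = cfc (fun x => f x * g x) X :=
  (cfc_mul f g X (X.finite_real_spectrum.continuousOn f)
    (X.finite_real_spectrum.continuousOn g)).symm

/-- Minus the quantum relative entropy: `tr X log A - tr X log X`. -/
noncomputable def negRelEntropy (X A : Matrix ι ι ℂ) : ℝ :=
  (X * cfc Real.log A).trace.re - (X * cfc Real.log X).trace.re

lemma IsHermitian.re_trace_eq_sum_overlap_left {X A : Matrix ι ι ℂ} (hX : X.IsHermitian)
    (hA : A.IsHermitian) :
    X.trace.re = ∑ i, ∑ j, ‖hX.overlap hA i j‖ ^ 2 * hX.eigenvalues i := by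
  have := hX.re_trace_cfc_mul_cfc hA (fun x => x) (fun _ => 1)
  rw [hX.cfc_id, hA.cfc_one, mul_one] at this
  simpa using this

lemma IsHermitian.re_trace_eq_sum_overlap_right {X A : Matrix ι ι ℂ} (hX : X.IsHermitian)
    (hA : A.IsHermitian) :
    A.trace.re = ∑ i, ∑ j, ‖hX.overlap hA i j‖ ^ 2 * hA.eigenvalues j := by
  have := hX.re_trace_cfc_mul_cfc hA (fun _ => 1) (fun x => x)
  rw [hA.cfc_id, hX.cfc_one, one_mul] at this
  simpa using this

lemma IsHermitian.negRelEntropy_eq {X A : Matrix ι ι ℂ} (hX : X.IsHermitian)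
    (hA : A.IsHermitian) :
    negRelEntropy X A = ∑ i, ∑ j, ‖hX.overlap hA i j‖ ^ 2 *
      (hX.eigenvalues i * (Real.log (hA.eigenvalues j) - Real.log (hX.eigenvalues i))) := by
  have h1 := hX.re_trace_cfc_mul_cfc hA (fun x => x) Real.log
  have h2 := hX.re_trace_cfc_mul_cfc hA (fun x => x * Real.log x) (fun _ => 1)
  rw [hX.cfc_id] at h1
  rw [← cfc_mul_matrix (fun x => x) Real.log, hX.cfc_id, hA.cfc_one, mul_one] at h2
  rw [negRelEntropy, h1, h2, ← Finset.sum_sub_distrib]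
  refine Finset.sum_congr rfl fun i _ => ?_
  rw [← Finset.sum_sub_distrib]
  refine Finset.sum_congr rfl fun j _ => ?_
  ring

/-- Klein's inequality. -/
lemma PosDef.negRelEntropy_add_trace_le {X K : Matrix ι ι ℂ} (hX : X.PosDef) (hK : K.PosDef) :
    negRelEntropy X K + X.trace.re ≤ K.trace.re := by
  rw [hX.1.negRelEntropy_eq hK.1, hX.1.re_trace_eq_sum_overlap_left hK.1,
    hX.1.re_trace_eq_sum_overlap_right hK.1, ← Finset.sum_add_distrib]
  refine Finset.sum_le_sum fun i _ => ?_
  rw [← Finset.sum_add_distrib]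
  refine Finset.sum_le_sum fun j _ => ?_
  rw [← mul_add]
  refine mul_le_mul_of_nonneg_left ?_ (by positivity)
  have hx := hX.eigenvalues_pos i
  have hk := hK.eigenvalues_pos j
  rw [← Real.log_div hk.ne' hx.ne']
  have := Real.log_le_sub_one_of_pos (div_pos hk hx)
  calc _ ≤ hX.1.eigenvalues i * (hK.1.eigenvalues j / hX.1.eigenvalues i - 1)
        + hX.1.eigenvalues i := by gcongr
    _ = _ := by field_simp; ring

/-- For fixed `W`, a real-linear function of `(X, A)`; its supremum over `W` is `⟨X, T⁻¹ X⟩` for the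
positive operator `T Y = (1 - s) • X Y + s • Y A` and the Hilbert-Schmidt inner product. -/
noncomputable def quadForm (s : ℝ) (W X A : Matrix ι ι ℂ) : ℝ :=
  2 * (Wᴴ * X).trace.re - (1 - s) * (Wᴴ * X * W).trace.re - s * (Wᴴ * W * A).trace.re

lemma quadForm_add_smul (s : ℝ) (W X Y A B : Matrix ι ι ℂ) (a b : ℝ) :
    quadForm s W (a • X + b • Y) (a • A + b • B) =
      a * quadForm s W X A + b * quadForm s W Y B := by
  simp only [quadForm, mul_add, add_mul, trace_add, Matrix.mul_smul, Matrix.smul_mul, trace_smul,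
    Complex.add_re, Complex.smul_re, smul_eq_mul]
  ring

/-- The value of `⟨X, T⁻¹ X⟩`, with `T` as in `quadForm`, in the eigenbases of `X` and `A`. -/
noncomputable def quadOverLin (s : ℝ) {X A : Matrix ι ι ℂ} (hX : X.IsHermitian)
    (hA : A.IsHermitian) : ℝ :=
  ∑ i, ∑ j, ‖hX.overlap hA i j‖ ^ 2 *
    (hX.eigenvalues i ^ 2 / ((1 - s) * hX.eigenvalues i + s * hA.eigenvalues j))

/-- In the two eigenbases, `quadForm` is a sum of scalar quadratic polynomials, one for each entry
of `W`. -/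
lemma quadForm_conj (s : ℝ) {X A : Matrix ι ι ℂ} (hX : X.IsHermitian) (hA : A.IsHermitian)
    (w : Matrix ι ι ℂ) :
    quadForm s ((hX.eigenvectorUnitary : Matrix ι ι ℂ) * w *
      (hA.eigenvectorUnitary : Matrix ι ι ℂ)ᴴ) X A =
    ∑ i, ∑ j, (2 * hX.eigenvalues i * (star (w i j) * hX.overlap hA i j).re -
      ((1 - s) * hX.eigenvalues i + s * hA.eigenvalues j) * ‖w i j‖ ^ 2) := by
  set U := (hX.eigenvectorUnitary : Matrix ι ι ℂ) with hU
  set V := (hA.eigenvectorUnitary : Matrix ι ι ℂ) with hV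
  set D := diagonal (fun i => (hX.eigenvalues i : ℂ)) with hD
  set E := diagonal (fun i => (hA.eigenvalues i : ℂ)) with hE
  have hUU : Uᴴ * U = 1 := hX.conjTranspose_eigenvectorUnitary_mul
  have hVV : Vᴴ * V = 1 := hA.conjTranspose_eigenvectorUnitary_mul
  have hUU' (Z : Matrix ι ι ℂ) : Uᴴ * (U * Z) = Z := by rw [← mul_assoc, hUU, one_mul]
  have hVV' (Z : Matrix ι ι ℂ) : Vᴴ * (V * Z) = Z := by rw [← mul_assoc, hVV, one_mul]
  have hXD : X = U * D * Uᴴ := by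
    have := hX.cfc_eq_conj (fun x => x)
    rwa [hX.cfc_id] at this
  have hAE : A = V * E * Vᴴ := by
    have := hA.cfc_eq_conj (fun x => x)
    rwa [hA.cfc_id] at this
  have hO : hX.overlap hA = Uᴴ * V := rfl
  have e1 : ((U * w * Vᴴ)ᴴ * X).trace = (wᴴ * (D * hX.overlap hA)).trace := by
    rw [hO, hXD]
    simp only [conjTranspose_mul, conjTranspose_conjTranspose, mul_assoc, hUU']
    rw [trace_mul_comm]
    simp only [mul_assoc]
  have e2 : ((U * w * Vᴴ)ᴴ * X * (U * w * Vᴴ)).trace = (wᴴ * (D * w)).trace := by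
    rw [hXD]
    simp only [conjTranspose_mul, conjTranspose_conjTranspose, mul_assoc, hUU']
    rw [trace_mul_comm]
    simp only [mul_assoc, hVV, mul_one]
  have e3 : ((U * w * Vᴴ)ᴴ * (U * w * Vᴴ) * A).trace = (wᴴ * (w * E)).trace := by
    rw [hAE]
    simp only [conjTranspose_mul, conjTranspose_conjTranspose, mul_assoc, hUU', hVV']
    rw [trace_mul_comm]
    simp only [mul_assoc, hVV, mul_one]
  have key (Y : Matrix ι ι ℂ) : (wᴴ * Y).trace.re = ∑ i, ∑ j, (star (w i j) * Y i j).re := by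
    rw [trace, Finset.sum_comm, Complex.re_sum]
    refine Finset.sum_congr rfl fun i _ => ?_
    rw [diag_apply, mul_apply, Complex.re_sum]
    rfl
  rw [quadForm, e1, e2, e3, key, key, key]
  simp only [Finset.mul_sum, ← Finset.sum_sub_distrib]
  refine Finset.sum_congr rfl fun i _ => Finset.sum_congr rfl fun j _ => ?_
  rw [hD, hE, diagonal_mul, diagonal_mul, mul_diagonal, ← Complex.normSq_eq_norm_sq,
    Complex.normSq_apply]
  simp
  ring

lemma quadForm_le_quadOverLin {s : ℝ} (hs0 : 0 ≤ s) (hs1 : s ≤ 1) {X A : Matrix ι ι ℂ}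
    (hX : X.PosDef) (hA : A.PosDef) (W : Matrix ι ι ℂ) :
    quadForm s W X A ≤ quadOverLin s hX.1 hA.1 := by
  obtain ⟨w, rfl⟩ : ∃ w, W = (hX.1.eigenvectorUnitary : Matrix ι ι ℂ) * w *
      (hA.1.eigenvectorUnitary : Matrix ι ι ℂ)ᴴ := by
    refine ⟨(hX.1.eigenvectorUnitary : Matrix ι ι ℂ)ᴴ * W * hA.1.eigenvectorUnitary, ?_⟩
    rw [← mul_assoc, ← mul_assoc, hX.1.eigenvectorUnitary_mul_conjTranspose, one_mul, mul_assoc,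
      hA.1.eigenvectorUnitary_mul_conjTranspose, mul_one]
  rw [quadForm_conj, quadOverLin]
  refine Finset.sum_le_sum fun i _ => Finset.sum_le_sum fun j _ => ?_
  have hx := hX.eigenvalues_pos i
  have ha := hA.eigenvalues_pos j
  set x := hX.1.eigenvalues i
  set a := hA.1.eigenvalues j
  set O := hX.1.overlap hA.1 i j
  have hT := Real.one_sub_mul_add_mul_pos hx ha hs0 hs1
  set T := (1 - s) * x + s * a
  rw [← mul_div_assoc, le_div_iff₀ hT]
  rw [← Complex.normSq_eq_norm_sq, ← Complex.normSq_eq_norm_sq, Complex.normSq_apply,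
    Complex.normSq_apply]
  simp only [Complex.star_def, Complex.mul_re, Complex.conj_re, Complex.conj_im]
  -- Complete the square.
  nlinarith [sq_nonneg (T * (w i j).re - x * O.re), sq_nonneg (T * (w i j).im - x * O.im)]

lemma exists_quadForm_eq_quadOverLin {s : ℝ} (hs0 : 0 ≤ s) (hs1 : s ≤ 1) {X A : Matrix ι ι ℂ}
    (hX : X.PosDef) (hA : A.PosDef) :
    ∃ W, quadForm s W X A = quadOverLin s hX.1 hA.1 := by
  -- The maximizer solves `T W = X`, which is diagonal in the two eigenbases.
  refine ⟨(hX.1.eigenvectorUnitary : Matrix ι ι ℂ) * (of fun i j =>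
    ((hX.1.eigenvalues i / ((1 - s) * hX.1.eigenvalues i + s * hA.1.eigenvalues j) : ℝ) : ℂ) *
      hX.1.overlap hA.1 i j) * (hA.1.eigenvectorUnitary : Matrix ι ι ℂ)ᴴ, ?_⟩
  rw [quadForm_conj, quadOverLin]
  refine Finset.sum_congr rfl fun i _ => Finset.sum_congr rfl fun j _ => ?_
  have hx := hX.eigenvalues_pos i
  have ha := hA.eigenvalues_pos j
  rw [of_apply]
  set x := hX.1.eigenvalues i
  set a := hA.1.eigenvalues j
  set O := hX.1.overlap hA.1 i j
  have hT := Real.one_sub_mul_add_mul_pos hx ha hs0 hs1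
  set T := (1 - s) * x + s * a
  rw [← Complex.normSq_eq_norm_sq, ← Complex.normSq_eq_norm_sq, Complex.normSq_apply,
    Complex.normSq_apply]
  simp only [Complex.star_def, Complex.mul_re, Complex.conj_re, Complex.conj_im, Complex.mul_im,
    Complex.ofReal_re, Complex.ofReal_im]
  field_simp
  ring

/-- A supremum of linear functions is jointly convex. -/
lemma quadOverLin_add_smul_le {s : ℝ} (hs0 : 0 ≤ s) (hs1 : s ≤ 1) {X Y A B : Matrix ι ι ℂ}
    (hX : X.PosDef) (hY : Y.PosDef) (hA : A.PosDef) (hB : B.PosDef) {a b : ℝ} (ha : 0 ≤ a)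
    (hb : 0 ≤ b) (hXY : (a • X + b • Y).PosDef) (hAB : (a • A + b • B).PosDef) :
    quadOverLin s hXY.1 hAB.1 ≤
      a * quadOverLin s hX.1 hA.1 + b * quadOverLin s hY.1 hB.1 := by
  obtain ⟨W, hW⟩ := exists_quadForm_eq_quadOverLin hs0 hs1 hXY hAB
  rw [← hW, quadForm_add_smul]
  gcongr <;> exact quadForm_le_quadOverLin hs0 hs1 ‹_› ‹_› W

/-- The relative entropy is an integral, with positive weights, of the functions
`quadOverLin s - tr X`, which are jointly convex. -/
lemma PosDef.negRelEntropy_eq_integral {X A : Matrix ι ι ℂ} (hX : X.PosDef) (hA : A.PosDef) :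
    IntervalIntegrable (fun s => (X.trace.re - quadOverLin s hX.1 hA.1) / s) volume 0 1 ∧
    ∫ s in (0 : ℝ)..1, (X.trace.re - quadOverLin s hX.1 hA.1) / s = negRelEntropy X A := by
  have hcongr : ∀ s ∈ Set.Ioc (0 : ℝ) 1, ∑ i, ∑ j, ‖hX.1.overlap hA.1 i j‖ ^ 2 *
      (hX.1.eigenvalues i * (hA.1.eigenvalues j - hX.1.eigenvalues i) /
        ((1 - s) * hX.1.eigenvalues i + s * hA.1.eigenvalues j)) =
      (X.trace.re - quadOverLin s hX.1 hA.1) / s := by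
    intro s hs
    rw [hX.1.re_trace_eq_sum_overlap_left hA.1, quadOverLin, ← Finset.sum_sub_distrib,
      Finset.sum_div]
    refine Finset.sum_congr rfl fun i _ => ?_
    rw [← Finset.sum_sub_distrib, Finset.sum_div]
    refine Finset.sum_congr rfl fun j _ => ?_
    have hx := hX.eigenvalues_pos i
    have ha := hA.eigenvalues_pos j
    have hs0 := hs.1
    have hT := Real.one_sub_mul_add_mul_pos hx ha hs0.le hs.2
    generalize hTs : (1 - s) * hX.1.eigenvalues i + s * hA.1.eigenvalues j = T at hT ⊢
    rw [← mul_sub, mul_div_assoc (‖hX.1.overlap hA.1 i j‖ ^ 2)]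
    congr 1
    field_simp
    rw [← hTs]
    ring
  have hterm (i j : ι) := (Real.intervalIntegral_mul_sub_div (hX.eigenvalues_pos i)
    (hA.eigenvalues_pos j)).1.const_mul (‖hX.1.overlap hA.1 i j‖ ^ 2)
  have hint : IntervalIntegrable (fun s => ∑ i, ∑ j, ‖hX.1.overlap hA.1 i j‖ ^ 2 *
      (hX.1.eigenvalues i * (hA.1.eigenvalues j - hX.1.eigenvalues i) /
        ((1 - s) * hX.1.eigenvalues i + s * hA.1.eigenvalues j))) volume 0 1 := by
    have := IntervalIntegrable.sum (μ := volume) (a := 0) (b := 1) Finset.univ fun i _ =>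
      IntervalIntegrable.sum Finset.univ fun j _ => hterm i j
    exact this.congr fun s _ => by simp only [Finset.sum_apply]
  rw [← Set.uIoc_of_le zero_le_one] at hcongr
  refine ⟨hint.congr hcongr, ?_⟩
  rw [← intervalIntegral.integral_congr_ae (.of_forall hcongr), hX.1.negRelEntropy_eq hA.1,
    intervalIntegral.integral_finsetSum]
  · refine Finset.sum_congr rfl fun i _ => ?_
    rw [intervalIntegral.integral_finsetSum fun j _ => hterm i j]
    refine Finset.sum_congr rfl fun j _ => ?_
    rw [intervalIntegral.integral_const_mul,
      (Real.intervalIntegral_mul_sub_div (hX.eigenvalues_pos i) (hA.eigenvalues_pos j)).2]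
  · intro i _
    have := IntervalIntegrable.sum (μ := volume) (a := 0) (b := 1) Finset.univ fun j _ => hterm i j
    exact this.congr fun s _ => by simp only [Finset.sum_apply]

/-- Joint convexity of the quantum relative entropy. -/
lemma PosDef.negRelEntropy_add_smul_ge {X Y A B : Matrix ι ι ℂ}
    (hX : X.PosDef) (hY : Y.PosDef) (hA : A.PosDef) (hB : B.PosDef) {a b : ℝ} (ha : 0 ≤ a)
    (hb : 0 ≤ b) (hXY : (a • X + b • Y).PosDef) (hAB : (a • A + b • B).PosDef) :
    a * negRelEntropy X A + b * negRelEntropy Y B ≤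
      negRelEntropy (a • X + b • Y) (a • A + b • B) := by
  obtain ⟨i1, e1⟩ := hX.negRelEntropy_eq_integral hA
  obtain ⟨i2, e2⟩ := hY.negRelEntropy_eq_integral hB
  obtain ⟨i3, e3⟩ := hXY.negRelEntropy_eq_integral hAB
  rw [← e1, ← e2, ← e3, ← intervalIntegral.integral_const_mul,
    ← intervalIntegral.integral_const_mul,
    ← intervalIntegral.integral_add (i1.const_mul a) (i2.const_mul b)]
  refine intervalIntegral.integral_mono_on_of_le_Ioo zero_le_one
    ((i1.const_mul a).add (i2.const_mul b)) i3 fun s hs => ?_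
  have h := quadOverLin_add_smul_le hs.1.le hs.2.le hX hY hA hB ha hb hXY hAB
  have ht : (a • X + b • Y).trace.re = a * X.trace.re + b * Y.trace.re := by
    simp [trace_add, trace_smul]
  rw [ht, ← mul_div_assoc, ← mul_div_assoc, ← add_div]
  refine div_le_div_of_nonneg_right ?_ hs.1.le
  linarith

end Matrix

/-! ### Exponential and logarithm of Hermitian matrices -/

namespace Matrix

open scoped ComplexOrder Topology

variable {ι : Type*} [Fintype ι] [DecidableEq ι]

lemma IsHermitian.cfc_exp_eq {H : Matrix ι ι ℂ} (hH : H.IsHermitian) :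
    cfc Real.exp H = NormedSpace.exp H := by
  have hinv : (hH.eigenvectorUnitary : Matrix ι ι ℂ)⁻¹ = (hH.eigenvectorUnitary : Matrix ι ι ℂ)ᴴ :=
    inv_eq_right_inv hH.eigenvectorUnitary_mul_conjTranspose
  have hunit : IsUnit (hH.eigenvectorUnitary : Matrix ι ι ℂ) :=
    IsUnit.of_mul_eq_one _ hH.eigenvectorUnitary_mul_conjTranspose
  have h := hH.cfc_eq_conj fun x => x
  rw [hH.cfc_id] at h
  conv_rhs => rw [h]
  rw [hH.cfc_eq_conj, ← hinv, exp_conj _ _ hunit, exp_diagonal]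
  congr 3
  funext i
  rw [Pi.coe_exp, Complex.ofReal_exp, Complex.exp_eq_exp_ℂ]

lemma IsHermitian.cfc_log_exp {H : Matrix ι ι ℂ} (hH : H.IsHermitian) :
    cfc Real.log (NormedSpace.exp H) = H := by
  rw [← hH.cfc_exp_eq]
  have := cfc_comp' Real.log Real.exp H
    ((H.finite_real_spectrum.image _).continuousOn _) (H.finite_real_spectrum.continuousOn _) hH
  simp only [Real.log_exp] at this
  exact this.symm.trans hH.cfc_id

lemma continuous_exp : Continuous (NormedSpace.exp : Matrix ι ι ℂ → Matrix ι ι ℂ) := by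
  open scoped Matrix.Norms.Operator in exact NormedSpace.exp_continuous

lemma hasSum_exp {𝕜 : Type*} [RCLike 𝕜] (A : Matrix ι ι 𝕜) :
    HasSum (fun k : ℕ => ((k.factorial : 𝕜)⁻¹) • A ^ k) (NormedSpace.exp A) := by
  open scoped Matrix.Norms.Operator in exact NormedSpace.exp_series_hasSum_exp' A

lemma isHermitian_cfc (f : ℝ → ℝ) (A : Matrix ι ι ℂ) : (cfc f A).IsHermitian :=
  cfc_predicate f A

lemma IsHermitian.posDef_exp {H : Matrix ι ι ℂ} (hH : H.IsHermitian) :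
    (NormedSpace.exp H).PosDef := by
  have hhalf : ((1 / 2 : ℝ) • H).IsHermitian := by
    rw [IsHermitian, conjTranspose_smul, hH, star_trivial]
  have h : NormedSpace.exp H =
      (NormedSpace.exp ((1 / 2 : ℝ) • H))ᴴ * NormedSpace.exp ((1 / 2 : ℝ) • H) := by
    rw [hhalf.exp, ← exp_add_of_commute _ _ (Commute.refl _), ← add_smul]
    norm_num
  rw [h]
  exact PosDef.conjTranspose_mul_self _ (mulVec_injective_of_isUnit (isUnit_exp _))

/-! ### Lieb's concavity theorem -/

/-- The function `A ↦ tr exp(H + log A)`, which is concave by Lieb's theorem. -/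
noncomputable def traceExpAddLog (H A : Matrix ι ι ℂ) : ℝ :=
  (NormedSpace.exp (H + cfc Real.log A)).trace.re

lemma negRelEntropy_exp {X A H : Matrix ι ι ℂ} (hH : H.IsHermitian) :
    negRelEntropy X (NormedSpace.exp (H + cfc Real.log A)) =
      (X * H).trace.re + negRelEntropy X A := by
  rw [negRelEntropy, negRelEntropy, (hH.add (isHermitian_cfc _ _)).cfc_log_exp, mul_add, trace_add,
    Complex.add_re]
  ring

/-- One half of the Gibbs variational formula for `traceExpAddLog`; equality holds at
`X = exp(H + log A)`. -/
lemma PosDef.le_traceExpAddLog {X A H : Matrix ι ι ℂ} (hX : X.PosDef) (hH : H.IsHermitian) :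
    (X * H).trace.re + negRelEntropy X A + X.trace.re ≤ traceExpAddLog H A := by
  rw [← negRelEntropy_exp hH]
  exact hX.negRelEntropy_add_trace_le (hH.add (isHermitian_cfc _ _)).posDef_exp

lemma traceExpAddLog_eq (A : Matrix ι ι ℂ) {H : Matrix ι ι ℂ} (hH : H.IsHermitian) :
    (NormedSpace.exp (H + cfc Real.log A) * H).trace.re +
      negRelEntropy (NormedSpace.exp (H + cfc Real.log A)) A +
      (NormedSpace.exp (H + cfc Real.log A)).trace.re = traceExpAddLog H A := by
  rw [← negRelEntropy_exp hH, negRelEntropy, sub_self, zero_add, traceExpAddLog]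

lemma PosDef.add_smul {κ : Type*} {X Y : Matrix κ κ ℂ} (hX : X.PosDef) (hY : Y.PosDef) {a b : ℝ}
    (ha : 0 ≤ a) (hb : 0 ≤ b) (hab : a + b = 1) : (a • X + b • Y).PosDef := by
  rcases ha.eq_or_lt with rfl | ha
  · have : b = 1 := by linarith
    simpa [this] using hY
  · exact (hX.smul ha).add_posSemidef (hY.posSemidef.smul hb)

/-- **Lieb's concavity theorem**: `A ↦ tr exp(H + log A)` is concave on positive definite matrices.
It is the partial supremum over `X` of a jointly concave function of `(X, A)`. -/
theorem concaveOn_traceExpAddLog {H : Matrix ι ι ℂ} (hH : H.IsHermitian) :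
    ConcaveOn ℝ {A : Matrix ι ι ℂ | A.PosDef} (traceExpAddLog H) := by
  refine ⟨fun A hA B hB a b ha hb hab => hA.add_smul hB ha hb hab,
    fun A hA B hB a b ha hb hab => ?_⟩
  rw [← traceExpAddLog_eq A hH, ← traceExpAddLog_eq B hH]
  have hX := (hH.add (isHermitian_cfc Real.log A)).posDef_exp
  have hY := (hH.add (isHermitian_cfc Real.log B)).posDef_exp
  set X := NormedSpace.exp (H + cfc Real.log A)
  set Y := NormedSpace.exp (H + cfc Real.log B)
  have hXY := hX.add_smul hY ha hb hab
  refine le_trans ?_ (hXY.le_traceExpAddLog hH)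
  have := hX.negRelEntropy_add_smul_ge hY hA hB ha hb hXY (PosDef.add_smul hA hB ha hb hab)
  have h1 : ((a • X + b • Y) * H).trace.re = a * (X * H).trace.re + b * (Y * H).trace.re := by
    simp [add_mul, trace_add, trace_smul]
  have h2 : (a • X + b • Y).trace.re = a * X.trace.re + b * Y.trace.re := by
    simp [trace_add, trace_smul]
  rw [h1, h2]
  simp only [smul_eq_mul]
  linarith

/-- Positive definiteness is an open condition on the Hermitian part. -/
lemma isOpen_posDef_add_conjTranspose {κ : Type*} [Fintype κ] :
    IsOpen {A : Matrix κ κ ℂ | (A + Aᴴ).PosDef} := by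
  have hset : {A : Matrix κ κ ℂ | (A + Aᴴ).PosDef} =
      {A | ∀ x ∈ Metric.sphere (0 : κ → ℂ) 1, 0 < (star x ⬝ᵥ ((A + Aᴴ) *ᵥ x)).re} := by
    ext A
    constructor
    · intro hA x hx
      exact hA.re_dotProduct_pos (Metric.ne_of_mem_sphere hx one_ne_zero)
    · intro hA
      have hH : (A + Aᴴ).IsHermitian := isHermitian_add_transpose_self A
      refine PosDef.of_dotProduct_mulVec_pos hH fun x hx => ?_
      have hx' : 0 < ‖x‖ := norm_pos_iff.2 hx
      have him : (star x ⬝ᵥ ((A + Aᴴ) *ᵥ x)).im = 0 := hH.im_star_dotProduct_mulVec_self x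
      have h := hA ((‖x‖⁻¹ : ℝ) • x) (by simp [norm_smul, hx'.ne'])
      rw [mulVec_smul, star_smul, smul_dotProduct, dotProduct_smul, star_trivial,
        Complex.smul_re, Complex.smul_re, smul_eq_mul, smul_eq_mul] at h
      have hr : 0 < (star x ⬝ᵥ ((A + Aᴴ) *ᵥ x)).re := by
        have h' : 0 < ‖x‖⁻¹ := inv_pos.2 hx'
        exact pos_of_mul_pos_right (pos_of_mul_pos_right h h'.le) h'.le
      exact Complex.pos_iff.2 ⟨hr, him.symm⟩
  rw [hset, isOpen_iff_mem_nhds]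
  intro A hA
  refine (isCompact_sphere (0 : κ → ℂ) 1).eventually_forall_of_forall_eventually fun x hx => ?_
  have hc : Continuous fun z : Matrix κ κ ℂ × (κ → ℂ) =>
      (star z.2 ⬝ᵥ ((z.1 + z.1ᴴ) *ᵥ z.2)).re := by fun_prop
  exact hc.continuousAt.eventually_const_lt (hA x hx)

end Matrix

/-! ### Supporting functionals -/

/-- A concave function on an open convex set of a finite-dimensional space has a supporting affine
function at every point. -/
lemma ConcaveOn.exists_continuousLinearMap_le {E : Type*} [NormedAddCommGroup E] [NormedSpace ℝ E]
    [FiniteDimensional ℝ E] {s : Set E} {f : E → ℝ} (hf : ConcaveOn ℝ s f) (hs : IsOpen s) {x : E}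
    (hx : x ∈ s) : ∃ l : E →L[ℝ] ℝ, ∀ y ∈ s, f y ≤ f x + l (y - x) := by
  have hopen : IsOpen {p : E × ℝ | p.1 ∈ s ∧ p.2 < f p.1} := by
    rw [isOpen_iff_mem_nhds]
    rintro ⟨y, r⟩ ⟨hy, hr⟩
    have hcont : ContinuousAt f y := (hf.continuousOn hs).continuousAt (hs.mem_nhds hy)
    have h1 : ∀ᶠ p : E × ℝ in nhds (y, r), p.1 ∈ s :=
      continuousAt_fst.eventually_mem (hs.mem_nhds hy)
    have h2 : ∀ᶠ p : E × ℝ in nhds (y, r), p.2 < f p.1 :=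
      ContinuousAt.eventually_lt continuousAt_snd
        (ContinuousAt.comp (x := (y, r)) (f := Prod.fst) hcont continuousAt_fst) hr
    filter_upwards [h1, h2] with p hp1 hp2 using ⟨hp1, hp2⟩
  -- Separate the open strict hypograph from its boundary point over `x`.
  obtain ⟨L, hL⟩ := geometric_hahn_banach_open_point hf.convex_strict_hypograph hopen
    (x := (x, f x)) (fun h => lt_irrefl _ h.2)
  have hsplit (y : E) (r : ℝ) : L (y, r) = L (y, 0) + r * L (0, 1) := by
    rw [← smul_eq_mul, ← map_smul, ← map_add]
    simp
  set c := L (0, 1) with hc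
  have hcpos : 0 < c := by
    have := hL (x, f x - 1) ⟨hx, by simp⟩
    rw [hsplit x (f x - 1), hsplit x (f x)] at this
    linarith
  refine ⟨-(c⁻¹ • L.comp (ContinuousLinearMap.inl ℝ E ℝ)), fun y hy => ?_⟩
  have hle : L (y, f y) ≤ L (x, f x) := by
    refine le_of_forall_pos_le_add fun ε hε => ?_
    have := hL (y, f y - ε / c) ⟨hy, by simpa using div_pos hε hcpos⟩
    rw [hsplit y (f y - ε / c), sub_mul, div_mul_cancel₀ _ hcpos.ne'] at this
    rw [hsplit y (f y)]
    linarith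
  rw [hsplit y (f y), hsplit x (f x)] at hle
  have hd : L (y - x, 0) = L (y, 0) - L (x, 0) := by
    rw [← map_sub]
    simp
  simp only [neg_apply, smul_apply,
    ContinuousLinearMap.comp_apply, ContinuousLinearMap.inl_apply, hd, smul_eq_mul]
  have : f y - f x ≤ c⁻¹ * -(L (y, 0) - L (x, 0)) := by
    rw [inv_mul_eq_div, le_div_iff₀ hcpos]
    linarith
  linarith

namespace Matrix
open scoped ComplexOrder Topology

variable {ι : Type*} [Fintype ι] [DecidableEq ι]

open scoped Matrix.Norms.Operator in
/-- A supporting functional for Lieb's concave function. The function is first composed with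
the Hermitian part, since positive definite matrices are not open among all matrices. -/
lemma PosDef.exists_linearMap_traceExpAddLog_le {H M : Matrix ι ι ℂ} (hH : H.IsHermitian)
    (hM : M.PosDef) : ∃ l : Matrix ι ι ℂ →ₗ[ℝ] ℝ, ∀ A : Matrix ι ι ℂ, A.PosDef →
      traceExpAddLog H A ≤ traceExpAddLog H M + l (A - M) := by
  let re : Matrix ι ι ℂ →ₗ[ℝ] Matrix ι ι ℂ :=
    { toFun := fun A => (1 / 2 : ℝ) • (A + Aᴴ)
      map_add' := fun A B => by
        rw [conjTranspose_add, ← smul_add]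
        abel_nf
      map_smul' := fun r A => by
        rw [conjTranspose_smul, star_trivial, ← smul_add, smul_comm]
        rfl }
  have hre (A : Matrix ι ι ℂ) (hA : A.IsHermitian) : re A = A := by
    change (1 / 2 : ℝ) • (A + Aᴴ) = A
    rw [hA, ← two_smul ℝ A, smul_smul]
    norm_num
  have hset : re ⁻¹' {A | A.PosDef} = {A | (A + Aᴴ).PosDef} := by
    ext A
    constructor
    · intro h
      have := PosDef.smul (a := (2 : ℝ)) h two_pos
      change ((2 : ℝ) • (1 / 2 : ℝ) • (A + Aᴴ)).PosDef at this
      rwa [smul_smul, mul_one_div_cancel two_ne_zero, one_smul] at this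
    · intro h
      exact PosDef.smul (a := (1 / 2 : ℝ)) h one_half_pos
  have hconc := (concaveOn_traceExpAddLog hH).comp_linearMap re
  have hopen : IsOpen (re ⁻¹' {A | A.PosDef}) := hset ▸ isOpen_posDef_add_conjTranspose
  obtain ⟨l, hl⟩ := hconc.exists_continuousLinearMap_le hopen (x := M)
    (by rw [Set.mem_preimage, hre M hM.1]; exact hM)
  refine ⟨l, fun A hA => ?_⟩
  have := hl A (by rw [Set.mem_preimage, hre A hA.1]; exact hA)
  rwa [Function.comp_apply, Function.comp_apply, hre A hA.1, hre M hM.1] at this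

end Matrix

/-! ### Intertwining operators -/

namespace Matrix

variable {ι κ : Type*} [Fintype ι] [DecidableEq ι] [Fintype κ] [DecidableEq κ]

/-- An operator intertwining two Hermitian matrices intertwines their functional calculi: in the
eigenbases, its entries vanish unless the corresponding eigenvalues agree. -/
lemma mul_cfc_eq_cfc_mul {A : Matrix ι ι ℂ} {B : Matrix κ κ ℂ} (hA : A.IsHermitian)
    (hB : B.IsHermitian) {R : Matrix κ ι ℂ} (h : R * A = B * R) (f : ℝ → ℝ) :
    R * cfc f A = cfc f B * R := by
  set U := (hA.eigenvectorUnitary : Matrix ι ι ℂ) with hU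
  set V := (hB.eigenvectorUnitary : Matrix κ κ ℂ) with hV
  have hUU : Uᴴ * U = 1 := hA.conjTranspose_eigenvectorUnitary_mul
  have hVV : Vᴴ * V = 1 := hB.conjTranspose_eigenvectorUnitary_mul
  have hU' : U * Uᴴ = 1 := hA.eigenvectorUnitary_mul_conjTranspose
  have hV' : V * Vᴴ = 1 := hB.eigenvectorUnitary_mul_conjTranspose
  have hAf (f : ℝ → ℝ) : cfc f A = U * diagonal (fun i => (f (hA.eigenvalues i) : ℂ)) * Uᴴ :=
    hA.cfc_eq_conj f
  have hBf (f : ℝ → ℝ) : cfc f B = V * diagonal (fun i => (f (hB.eigenvalues i) : ℂ)) * Vᴴ :=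
    hB.cfc_eq_conj f
  set W := Vᴴ * R * U with hW
  have hR : R = V * W * Uᴴ := by
    calc R = (V * Vᴴ) * R * (U * Uᴴ) := by rw [hU', hV', Matrix.one_mul, Matrix.mul_one]
      _ = V * W * Uᴴ := by simp only [hW, Matrix.mul_assoc]
  have key (f : ℝ → ℝ) : Vᴴ * (R * cfc f A) * U =
      W * diagonal (fun i => (f (hA.eigenvalues i) : ℂ)) := by
    simp only [hAf, hW, Matrix.mul_assoc, hUU, Matrix.mul_one]
  have key' (f : ℝ → ℝ) : Vᴴ * (cfc f B * R) * U =
      diagonal (fun i => (f (hB.eigenvalues i) : ℂ)) * W := by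
    simp only [hBf, hW, ← Matrix.mul_assoc, hVV, Matrix.one_mul]
  have hentry : W * diagonal (fun i => (hA.eigenvalues i : ℂ)) =
      diagonal (fun i => (hB.eigenvalues i : ℂ)) * W := by
    rw [← key fun x => x, ← key' fun x => x, hA.cfc_id, hB.cfc_id, h]
  have hf : W * diagonal (fun i => (f (hA.eigenvalues i) : ℂ)) =
      diagonal (fun i => (f (hB.eigenvalues i) : ℂ)) * W := by
    ext i j
    have hij := congrFun (congrFun hentry i) j
    rw [mul_diagonal, diagonal_mul, mul_comm] at hij ⊢
    by_cases hw : W i j = 0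
    · simp [hw]
    · rw [Complex.ofReal_inj.1 (mul_right_cancel₀ hw hij)]
  rw [← key, ← key'] at hf
  calc R * cfc f A = (V * Vᴴ) * (R * cfc f A) * (U * Uᴴ) := by
        rw [hU', hV', Matrix.one_mul, Matrix.mul_one]
    _ = V * (Vᴴ * (R * cfc f A) * U) * Uᴴ := by simp only [Matrix.mul_assoc]
    _ = V * (Vᴴ * (cfc f B * R) * U) * Uᴴ := by rw [hf]
    _ = (V * Vᴴ) * (cfc f B * R) * (U * Uᴴ) := by simp only [Matrix.mul_assoc]
    _ = cfc f B * R := by rw [hU', hV', Matrix.one_mul, Matrix.mul_one]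

end Matrix

namespace TProduct

open scoped Matrix

variable {m n q p : ℕ}

/-! ### The sum of the frontal slices -/

/-- The sum of the frontal slices of a tensor, that is, the frequency zero block of the block
diagonalization of `bcirc C` by the discrete Fourier transform. -/
def sliceSum (C : Tensor m n p) : Matrix (Fin m) (Fin n) ℂ :=
  Matrix.of fun i j => ∑ k, C i j k

lemma trace_sliceSum (C : Tensor m m p) : (sliceSum C).trace = ttrace C := rfl

lemma sliceSum_tmul [NeZero p] (C : Tensor m n p) (D : Tensor n q p) :
    sliceSum (tmul C D) = sliceSum C * sliceSum D := by
  ext i j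
  simp only [sliceSum, tmul, fold, bcirc, unfold, Matrix.mul_apply, Matrix.of_apply,
    Fintype.sum_prod_type]
  simp_rw [Finset.sum_mul_sum]
  rw [Finset.sum_comm]
  simp_rw [Finset.sum_comm (s := Finset.univ (α := Fin p)) (t := Finset.univ (α := Fin n))]
  refine Finset.sum_congr rfl fun r _ => ?_
  conv_rhs => rw [Finset.sum_comm]
  refine Finset.sum_congr rfl fun l _ => ?_
  exact (Equiv.subRight l).sum_comp fun k => C i r k * D r j l

lemma bcirc_tmul [NeZero p] (C : Tensor m n p) (D : Tensor n q p) :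
    bcirc (tmul C D) = bcirc C * bcirc D := by
  ext a b
  simp only [tmul, fold, bcirc, unfold, Matrix.mul_apply, Matrix.of_apply, Fintype.sum_prod_type]
  rw [← (Equiv.subRight b.1).sum_comp]
  refine Finset.sum_congr rfl fun l _ => Finset.sum_congr rfl fun r _ => ?_
  simp

lemma bcirc_identity [NeZero p] : bcirc (identity m p) = 1 := by
  ext a b
  simp [bcirc, identity, bcircInv, Matrix.one_apply, Prod.ext_iff, sub_eq_zero]

lemma bcirc_tpow [NeZero p] (C : Tensor m m p) (k : ℕ) : bcirc (tpow C k) = bcirc C ^ k := by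
  induction k with
  | zero => exact bcirc_identity
  | succ k ih => rw [tpow, bcirc_tmul, ih, pow_succ]

lemma sliceSum_identity [NeZero p] : sliceSum (identity m p) = 1 := by
  ext i j
  simp [sliceSum, identity, bcircInv, Matrix.one_apply, Prod.ext_iff, ite_and]

lemma sliceSum_tpow [NeZero p] (C : Tensor m m p) (k : ℕ) :
    sliceSum (tpow C k) = sliceSum C ^ k := by
  induction k with
  | zero => exact sliceSum_identity
  | succ k ih => rw [tpow, sliceSum_tmul, ih, pow_succ]

lemma sliceSum_hermTranspose [NeZero p] (C : Tensor m n p) :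
    sliceSum (hermTranspose C) = (sliceSum C)ᴴ := by
  ext i j
  simp only [sliceSum, hermTranspose, bcircInv, bcirc, Matrix.conjTranspose_apply, Matrix.of_apply,
    star_sum]
  exact (Equiv.subLeft 0).sum_comp fun k => star (C j i k)

lemma sliceSum_add (C D : Tensor m n p) : sliceSum (C + D) = sliceSum C + sliceSum D := by
  ext i j
  simp [sliceSum, Finset.sum_add_distrib]

lemma sliceSum_smul (t : ℝ) (C : Tensor m n p) : sliceSum (t • C) = t • sliceSum C := by
  ext i j
  simp [sliceSum, Finset.mul_sum]

lemma sliceSum_sum {ι : Type*} (s : Finset ι) (C : ι → Tensor m n p) :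
    sliceSum (∑ i ∈ s, C i) = ∑ i ∈ s, sliceSum (C i) :=
  map_sum (AddMonoidHom.mk' sliceSum sliceSum_add) C s

lemma continuous_sliceSum : Continuous (sliceSum : Tensor m n p → _) := by
  unfold sliceSum
  fun_prop

lemma continuous_bcirc : Continuous (bcirc : Tensor m n p → _) := by
  unfold bcirc
  fun_prop

lemma continuous_bcircInv [NeZero p] :
    Continuous (bcircInv : Matrix (Fin p × Fin m) (Fin p × Fin n) ℂ → _) := by
  unfold bcircInv
  fun_prop

/-- Summability of the exponential series, transported along `bcircInv` from the matrix
exponential. Without it, the `tsum` in `texp` would be a junk value. -/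
lemma hasSum_texp [NeZero p] (C : Tensor m m p) :
    HasSum (fun k : ℕ => ((k.factorial : ℂ)⁻¹) • tpow C k)
      (bcircInv (NormedSpace.exp (bcirc C))) := by
  have h := (Matrix.hasSum_exp (bcirc C)).map
    (AddMonoidHom.mk' bcircInv fun _ _ => rfl) (continuous_bcircInv (m := m) (n := m))
  refine h.congr_fun fun k => ?_
  rw [← bcircInv_bcirc (tpow C k), bcirc_tpow]
  rfl

lemma texp_eq [NeZero p] (C : Tensor m m p) :
    texp C = bcircInv (NormedSpace.exp (bcirc C)) :=
  (hasSum_texp C).tsum_eq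

lemma continuous_texp [NeZero p] : Continuous (texp : Tensor m m p → _) := by
  rw [funext texp_eq]
  exact continuous_bcircInv.comp (Matrix.continuous_exp.comp continuous_bcirc)

lemma sliceSum_texp [NeZero p] (C : Tensor m m p) :
    sliceSum (texp C) = NormedSpace.exp (sliceSum C) := by
  have h := (hasSum_texp C).map (AddMonoidHom.mk' sliceSum sliceSum_add)
    (continuous_sliceSum (m := m) (n := m))
  rw [← texp_eq] at h
  refine h.unique ((Matrix.hasSum_exp (sliceSum C)).congr_fun fun k => ?_)
  rw [← sliceSum_tpow]
  ext i j
  simp [sliceSum, Finset.mul_sum]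

lemma bcirc_texp [NeZero p] (C : Tensor m m p) :
    bcirc (texp C) = NormedSpace.exp (bcirc C) := by
  have h := (hasSum_texp C).map (AddMonoidHom.mk' bcirc fun _ _ => rfl)
    (continuous_bcirc (m := m) (n := m))
  rw [← texp_eq] at h
  refine h.unique ((Matrix.hasSum_exp (bcirc C)).congr_fun fun k => ?_)
  rw [← bcirc_tpow]
  rfl

lemma isHermitian_iff [NeZero p] {C : Tensor m m p} :
    IsHermitian C ↔ ∀ i j k, star (C j i (-k)) = C i j k := by
  simp [IsHermitian, funext_iff, hermTranspose, bcircInv, bcirc]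

lemma isHermitian_iff_bcirc [NeZero p] {C : Tensor m m p} :
    IsHermitian C ↔ (bcirc C).IsHermitian := by
  constructor
  · intro h
    ext a b
    rw [Matrix.conjTranspose_apply, bcirc, Matrix.of_apply, Matrix.of_apply,
      ← isHermitian_iff.1 h a.2 b.2 (a.1 - b.1), neg_sub]
  · intro h
    rw [IsHermitian, hermTranspose, h, bcircInv_bcirc]

lemma IsHermitian.sliceSum [NeZero p] {C : Tensor m m p} (h : IsHermitian C) :
    (sliceSum C).IsHermitian := by
  rw [Matrix.IsHermitian, ← sliceSum_hermTranspose, h]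

lemma IsHermitian.texp [NeZero p] {C : Tensor m m p} (h : IsHermitian C) :
    IsHermitian (texp C) := by
  rw [isHermitian_iff_bcirc, bcirc_texp]
  exact (isHermitian_iff_bcirc.1 h).exp

lemma IsHermitian.smul [NeZero p] {C : Tensor m m p} (h : IsHermitian C) (t : ℝ) :
    IsHermitian (t • C) := by
  rw [isHermitian_iff] at h ⊢
  intro i j k
  simp [← h i j k]

/-- Taking the sum of the slices commutes with the tensor logarithm: the block row of identity
matrices intertwines `bcirc C` with `sliceSum C`. -/
lemma sliceSum_tlog [NeZero p] {C : Tensor m m p} (h : IsHermitian C) :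
    sliceSum (tlog C) = cfc Real.log (sliceSum C) := by
  let R : Matrix (Fin m) (Fin p × Fin m) ℂ := Matrix.of fun i a => if i = a.2 then 1 else 0
  have hleft (N : Matrix (Fin p × Fin m) (Fin p × Fin m) ℂ) (i : Fin m) (b : Fin p × Fin m) :
      (R * N) i b = ∑ k, N (k, i) b := by
    simp [R, Matrix.mul_apply, Fintype.sum_prod_type]
  have hright (N : Matrix (Fin m) (Fin m) ℂ) (i : Fin m) (b : Fin p × Fin m) :
      (N * R) i b = N i b.2 := by
    simp [R, Matrix.mul_apply]
  have hR : R * bcirc C = sliceSum C * R := by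
    ext i b
    rw [hleft, hright]
    exact (Equiv.subRight b.1).sum_comp fun k => C i b.2 k
  have := Matrix.mul_cfc_eq_cfc_mul (isHermitian_iff_bcirc.1 h) h.sliceSum hR Real.log
  ext i j
  have hij := congrFun (congrFun this i) ((0 : Fin p), j)
  rwa [hleft, hright] at hij

/-! ### The exponential for the circular product -/

lemma circulant_circPow [NeZero p] (a : Fin p → ℝ) (k : ℕ) :
    Matrix.circulant (circPow a k) = Matrix.circulant a ^ k := by
  induction k with
  | zero =>
    ext i j
    simp [circPow, Matrix.one_apply, Pi.single_apply, sub_eq_zero]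
  | succ k ih => rw [circPow, circProd, ← Matrix.circulant_mul, ih, pow_succ]

lemma sum_circProd [NeZero p] (a b : Fin p → ℝ) :
    ∑ j, circProd a b j = (∑ j, a j) * ∑ j, b j := by
  simp only [circProd, Matrix.mulVec, dotProduct, Matrix.circulant_apply]
  rw [Finset.sum_comm, Finset.mul_sum]
  refine Finset.sum_congr rfl fun l _ => ?_
  rw [← Finset.sum_mul]
  congr 1
  exact (Equiv.subRight l).sum_comp a

lemma sum_circPow [NeZero p] (a : Fin p → ℝ) (k : ℕ) :
    ∑ j, circPow a k j = (∑ j, a j) ^ k := by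
  induction k with
  | zero => simp [circPow]
  | succ k ih => rw [circPow, sum_circProd, ih, pow_succ]

/-- The sum of coordinates is multiplicative for `⊙`, so it turns `circExp` into `Real.exp`. -/
lemma sum_circExp [NeZero p] (a : Fin p → ℝ) :
    ∑ j, circExp a j = Real.exp (∑ j, a j) := by
  have hs : Summable fun k : ℕ => ((k.factorial : ℝ)⁻¹) • circPow a k := by
    have h := (Matrix.hasSum_exp (Matrix.circulant a)).map
      (AddMonoidHom.mk' (fun M : Matrix (Fin p) (Fin p) ℝ => M.col 0) fun _ _ => rfl)
      (continuous_pi fun i => continuous_id.matrix_elem i 0)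
    refine h.summable.congr fun k => ?_
    change (((k.factorial : ℝ)⁻¹) • Matrix.circulant a ^ k).col 0 = _
    rw [← circulant_circPow]
    ext i
    simp
  have h1 := hs.hasSum.map (∑ j, LinearMap.proj j : (Fin p → ℝ) →ₗ[ℝ] ℝ)
    (LinearMap.continuous_of_finiteDimensional _)
  have h2 : HasSum (fun k : ℕ => (∑ j, a j) ^ k / k.factorial) (Real.exp (∑ j, a j)) := by
    rw [Real.exp_eq_exp_ℝ]
    exact NormedSpace.expSeries_div_hasSum_exp _
  have h3 := h1.unique (h2.congr_fun fun k => ?_)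
  · simpa [circExp] using h3
  · simp [← Finset.mul_sum, sum_circPow, div_eq_inv_mul]

end TProduct

namespace TProduct

open scoped Matrix ComplexOrder

variable {m p : ℕ}

lemma isHermitian_sliceSum_tlog [NeZero p] {C : Tensor m m p} (h : IsHermitian C) :
    (sliceSum (tlog C)).IsHermitian := by
  rw [sliceSum_tlog h]
  exact Matrix.isHermitian_cfc _ _

lemma IsHermitian.sum [NeZero p] {ι : Type*} {s : Finset ι} {C : ι → Tensor m m p}
    (h : ∀ i ∈ s, IsHermitian (C i)) : IsHermitian (∑ i ∈ s, C i) := by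
  simp only [isHermitian_iff] at h ⊢
  intro i j k
  simp only [Finset.sum_apply, star_sum]
  exact Finset.sum_congr rfl fun a ha => h a ha i j k

/-! ### Eigentuples and the trace -/

/-- The entries of `circExp (t • b)` are nonnegative with sum `exp (t ∑ b)`, and `t ∑ d` is an
eigenvalue of `sliceSum (t • S)`. -/
lemma IsMaxEigentuple.circExp_le_ttrace_texp [NeZero m] [NeZero p] {S : Tensor m m p}
    {b d : Fin p → ℝ} (hd : IsMaxEigentuple S d) (hbd : b ≤ d) {t : ℝ} (ht : 0 ≤ t)
    (hb : ∀ j, 0 ≤ circExp (t • b) j) (j : Fin p) :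
    circExp (t • b) j ≤ (ttrace (texp (t • S))).re := by
  obtain ⟨U, s, -, hU, -, hS, rfl⟩ := hd
  have hV : sliceSum U * (sliceSum U)ᴴ = 1 := by
    rw [← sliceSum_hermTranspose, ← sliceSum_tmul, hU, sliceSum_identity]
  have hdiag : sliceSum (fdiag s) = Matrix.diagonal fun i => ((∑ k, s i k : ℝ) : ℂ) := by
    ext i j
    by_cases hij : i = j
    · subst hij
      simp [sliceSum, fdiag]
    · simp [sliceSum, fdiag, hij]
  have hinv : (sliceSum U)⁻¹ = (sliceSum U)ᴴ := Matrix.inv_eq_right_inv hV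
  have hsum : sliceSum (t • S) = sliceSum U *
      Matrix.diagonal (fun i => ((t * ∑ k, s i k : ℝ) : ℂ)) * (sliceSum U)⁻¹ := by
    rw [hinv, sliceSum_smul, hS, sliceSum_tmul, sliceSum_tmul, sliceSum_hermTranspose, hdiag,
      ← Matrix.smul_mul, ← Matrix.mul_smul, ← Matrix.diagonal_smul]
    congr 3
    funext i
    simp
  have htr : (ttrace (texp (t • S))).re = ∑ i, Real.exp (t * ∑ k, s i k) := by
    rw [← trace_sliceSum, sliceSum_texp, hsum, Matrix.exp_conj _ _ (IsUnit.of_mul_eq_one _ hV),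
      Matrix.trace_mul_comm, ← Matrix.mul_assoc, hinv, mul_eq_one_comm.1 hV, Matrix.one_mul,
      Matrix.exp_diagonal, Matrix.trace_diagonal, Complex.re_sum]
    refine Finset.sum_congr rfl fun i _ => ?_
    rw [Pi.coe_exp, ← Complex.exp_eq_exp_ℂ, ← Complex.ofReal_exp, Complex.ofReal_re]
  calc circExp (t • b) j ≤ ∑ j, circExp (t • b) j :=
        Finset.single_le_sum (fun j _ => hb j) (Finset.mem_univ j)
    _ = Real.exp (t * ∑ k, b k) := by simp [sum_circExp, Finset.mul_sum]
    _ ≤ Real.exp (t * ∑ k, s 0 k) := by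
        gcongr with k
        exact hbd k
    _ ≤ ∑ i, Real.exp (t * ∑ k, s i k) :=
        Finset.single_le_sum (f := fun i => Real.exp (t * ∑ k, s i k))
          (fun i _ => (Real.exp_pos _).le) (Finset.mem_univ 0)
    _ = _ := htr.symm

/-! ### Averaging over independent summands -/

variable {Ω : Type*} [MeasurableSpace Ω] {μ : Measure Ω}

lemma integral_linearMap_comp {E : Type*} [NormedAddCommGroup E] [NormedSpace ℝ E] [CompleteSpace E]
    (l : Tensor m m p →ₗ[ℝ] E) {F : Ω → Tensor m m p} (hF : Integrable F μ) :
    Integrable (fun ω => l (F ω)) μ ∧ ∫ ω, l (F ω) ∂μ = l (∫ ω, F ω ∂μ) :=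
  ⟨(LinearMap.toContinuousLinearMap l).integrable_comp hF,
    (LinearMap.toContinuousLinearMap l).integral_comp_comm hF⟩

lemma isHermitian_integral [NeZero p] {F : Ω → Tensor m m p} (hF : Integrable F μ)
    (hherm : ∀ᵐ ω ∂μ, IsHermitian (F ω)) : IsHermitian (∫ ω, F ω ∂μ) := by
  rw [isHermitian_iff]
  intro i j k
  let l : Tensor m m p →ₗ[ℝ] ℂ :=
    { toFun := fun C => star (C j i (-k)) - C i j k
      map_add' := fun C D => by simp only [Pi.add_apply, star_add]; ring
      map_smul' := fun r C => by simp [mul_sub] }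
  have h := (integral_linearMap_comp l hF).2
  have h0 : ∫ ω, l (F ω) ∂μ = 0 := by
    refine integral_eq_zero_of_ae ?_
    filter_upwards [hherm] with ω hω
    exact sub_eq_zero.2 (isHermitian_iff.1 hω i j k)
  rw [h0] at h
  exact sub_eq_zero.1 h.symm

/-- `sliceSum` as a real-linear map. -/
def sliceSumLinear (m n p : ℕ) : Tensor m n p →ₗ[ℝ] Matrix (Fin m) (Fin n) ℂ where
  toFun := sliceSum
  map_add' := sliceSum_add
  map_smul' := sliceSum_smul

lemma posDef_sliceSum_integral [NeZero p] [IsProbabilityMeasure μ] {F : Ω → Tensor m m p}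
    (hF : Integrable F μ) (hherm : ∀ᵐ ω ∂μ, IsHermitian (F ω))
    (hpos : ∀ᵐ ω ∂μ, (sliceSum (F ω)).PosDef) : (sliceSum (∫ ω, F ω ∂μ)).PosDef := by
  have hH := (isHermitian_integral hF hherm).sliceSum
  refine Matrix.PosDef.of_dotProduct_mulVec_pos hH fun x hx => ?_
  let l : Tensor m m p →ₗ[ℝ] ℝ :=
    { toFun := fun C => (star x ⬝ᵥ (sliceSum C *ᵥ x)).re
      map_add' := fun C D => by
        rw [sliceSum_add, Matrix.add_mulVec, dotProduct_add, Complex.add_re]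
      map_smul' := fun r C => by
        rw [sliceSum_smul, Matrix.smul_mulVec, dotProduct_smul, Complex.smul_re]
        rfl }
  obtain ⟨hint, h⟩ := integral_linearMap_comp l hF
  have hl : ∀ᵐ ω ∂μ, 0 < l (F ω) := by
    filter_upwards [hpos] with ω hω using hω.re_dotProduct_pos hx
  have h0 : 0 < ∫ ω, l (F ω) ∂μ := by
    have hl' : ∀ᵐ ω ∂μ, 0 ≤ l (F ω) := hl.mono fun ω hω => hω.le
    refine (integral_nonneg_of_ae hl').lt_of_ne' fun h0 => ?_
    obtain ⟨ω, h1, h2⟩ := (hl.and ((integral_eq_zero_iff_of_nonneg_ae hl' hint).1 h0)).exists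
    exact h1.ne' h2
  rw [h] at h0
  exact Complex.pos_iff.2 ⟨h0, (hH.im_star_dotProduct_mulVec_self x).symm⟩

/-- Jensen's inequality for Lieb's concave function, evaluated at the random positive definite matrix
`sliceSum (texp (Y ω))`, whose logarithm is `sliceSum (Y ω)`. -/
lemma lintegral_trace_exp_add_le [NeZero p] [IsProbabilityMeasure μ] {Y : Ω → Tensor m m p}
    (hherm : ∀ᵐ ω ∂μ, IsHermitian (Y ω)) (hint : Integrable (fun ω => texp (Y ω)) μ)
    {H : Matrix (Fin m) (Fin m) ℂ} (hH : H.IsHermitian) :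
    ∫⁻ ω, ENNReal.ofReal (NormedSpace.exp (H + sliceSum (Y ω))).trace.re ∂μ ≤
      ENNReal.ofReal
        (NormedSpace.exp (H + sliceSum (tlog (∫ ω, texp (Y ω) ∂μ)))).trace.re := by
  have hhermexp : ∀ᵐ ω ∂μ, IsHermitian (texp (Y ω)) := hherm.mono fun ω hω => hω.texp
  have hposexp : ∀ᵐ ω ∂μ, (sliceSum (texp (Y ω))).PosDef := by
    filter_upwards [hherm] with ω hω
    rw [sliceSum_texp]
    exact hω.sliceSum.posDef_exp
  have hM := posDef_sliceSum_integral hint hhermexp hposexp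
  obtain ⟨l, hl⟩ := hM.exists_linearMap_traceExpAddLog_le hH
  rw [sliceSum_tlog (isHermitian_integral hint hhermexp)]
  set M := ∫ ω, texp (Y ω) ∂μ
  change _ ≤ ENNReal.ofReal (Matrix.traceExpAddLog H (sliceSum M))
  obtain ⟨hint', h⟩ := integral_linearMap_comp (l ∘ₗ sliceSumLinear m m p) hint
  have hbound : ∀ᵐ ω ∂μ, (NormedSpace.exp (H + sliceSum (Y ω))).trace.re ≤
      Matrix.traceExpAddLog H (sliceSum M) +
        ((l ∘ₗ sliceSumLinear m m p) (texp (Y ω)) - l (sliceSum M)) := by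
    filter_upwards [hherm, hposexp] with ω hω hpω
    have := hl _ hpω
    rwa [map_sub, Matrix.traceExpAddLog, sliceSum_texp, hω.sliceSum.cfc_log_exp,
      ← sliceSum_texp] at this
  have hnonneg : ∀ᵐ ω ∂μ, 0 ≤ (NormedSpace.exp (H + sliceSum (Y ω))).trace.re := by
    filter_upwards [hherm] with ω hω
    exact (Complex.le_def.1 (hH.add hω.sliceSum).posDef_exp.posSemidef.trace_nonneg).1
  have hint1 : Integrable
      (fun ω => (l ∘ₗ sliceSumLinear m m p) (texp (Y ω)) - l (sliceSum M)) μ :=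
    hint'.sub (integrable_const _)
  have hint2 : Integrable (fun ω => Matrix.traceExpAddLog H (sliceSum M) +
      ((l ∘ₗ sliceSumLinear m m p) (texp (Y ω)) - l (sliceSum M))) μ :=
    (integrable_const _).add hint1
  calc _ ≤ ∫⁻ ω, ENNReal.ofReal (Matrix.traceExpAddLog H (sliceSum M) +
        ((l ∘ₗ sliceSumLinear m m p) (texp (Y ω)) - l (sliceSum M))) ∂μ :=
        lintegral_mono_ae (hbound.mono fun ω hω => ENNReal.ofReal_le_ofReal hω)
    _ = ENNReal.ofReal (∫ ω, (Matrix.traceExpAddLog H (sliceSum M) +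
        ((l ∘ₗ sliceSumLinear m m p) (texp (Y ω)) - l (sliceSum M))) ∂μ) := by
        rw [ofReal_integral_eq_lintegral_ofReal hint2]
        filter_upwards [hbound, hnonneg] with ω h1 h2 using h2.trans h1
    _ = _ := by
        rw [integral_add (integrable_const _) hint1,
          integral_sub hint' (integrable_const _), h]
        simp [sliceSumLinear, M]

/-- Subadditivity of the matrix cumulant generating function: the summands are averaged one at a
time, the others being frozen by independence. -/
lemma lintegral_trace_exp_add_sum_le [NeZero p] [IsProbabilityMeasure μ] {ι : Type*}
    {Y : ι → Ω → Tensor m m p} (hmeas : ∀ i, Measurable (Y i))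
    (hherm : ∀ i, ∀ᵐ ω ∂μ, IsHermitian (Y i ω)) (hindep : iIndepFun Y μ)
    (hint : ∀ i, Integrable (fun ω => texp (Y i ω)) μ) (s : Finset ι)
    {H : Matrix (Fin m) (Fin m) ℂ} (hH : H.IsHermitian) :
    ∫⁻ ω, ENNReal.ofReal (NormedSpace.exp (H + sliceSum (∑ i ∈ s, Y i ω))).trace.re ∂μ ≤
      ENNReal.ofReal
        (NormedSpace.exp (H + sliceSum (∑ i ∈ s, tlog (∫ ω, texp (Y i ω) ∂μ)))).trace.re := by
  classical
  induction s using Finset.induction_on generalizing H with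
  | empty => simp
  | insert a s ha ih =>
    let Φ : Tensor m m p × Tensor m m p → ENNReal := fun z =>
      ENNReal.ofReal (NormedSpace.exp ((H + sliceSum z.1) + sliceSum z.2)).trace.re
    have hΦ : Measurable Φ := by
      have h1 : Continuous fun z : Tensor m m p × Tensor m m p =>
          NormedSpace.exp ((H + sliceSum z.1) + sliceSum z.2) :=
        Matrix.continuous_exp.comp ((continuous_const.add (continuous_sliceSum.comp
          continuous_fst)).add (continuous_sliceSum.comp continuous_snd))
      exact ENNReal.measurable_ofReal.comp
        (Complex.continuous_re.comp h1.matrix_trace).measurable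
    have hS : Measurable fun ω => ∑ i ∈ s, Y i ω := Finset.measurable_sum _ fun i _ => hmeas i
    have hSherm : ∀ᵐ ω ∂μ, IsHermitian (∑ i ∈ s, Y i ω) := by
      filter_upwards [(Filter.eventually_all_finset s).2 fun i _ => hherm i] with ω hω
      exact IsHermitian.sum hω
    have hind : IndepFun (fun ω => ∑ i ∈ s, Y i ω) (Y a) μ := by
      have := hindep.indepFun_finsetSum_of_notMem hmeas ha
      rwa [Finset.sum_fn] at this
    have hlog := isHermitian_sliceSum_tlog
      (isHermitian_integral (hint a) ((hherm a).mono fun ω hω => hω.texp))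
    calc _ = ∫⁻ ω, Φ (∑ i ∈ s, Y i ω, Y a ω) ∂μ := by
          refine lintegral_congr fun ω => ?_
          simp only [Φ]
          rw [Finset.sum_insert ha, sliceSum_add, add_assoc, add_comm (sliceSum (Y a ω))]
      _ = ∫⁻ ω, ∫⁻ ω', Φ (∑ i ∈ s, Y i ω, Y a ω') ∂μ ∂μ := by
          rw [← lintegral_map hΦ (hS.prodMk (hmeas a)),
            (indepFun_iff_map_prod_eq_prod_map_map hS.aemeasurable (hmeas a).aemeasurable).1 hind,
            lintegral_prod _ hΦ.aemeasurable, lintegral_map hΦ.lintegral_prod_right' hS]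
          refine lintegral_congr fun ω => ?_
          have hΦω : Measurable fun D => Φ (∑ i ∈ s, Y i ω, D) := hΦ.comp measurable_prodMk_left
          rw [lintegral_map hΦω (hmeas a)]
      _ ≤ ∫⁻ ω, ENNReal.ofReal (NormedSpace.exp ((H + sliceSum (tlog (∫ ω, texp (Y a ω) ∂μ))) +
            sliceSum (∑ i ∈ s, Y i ω))).trace.re ∂μ := by
          refine lintegral_mono_ae ?_
          filter_upwards [hSherm] with ω hω
          have h := lintegral_trace_exp_add_le (hherm a) (hint a) (hH.add hω.sliceSum)
          rw [add_right_comm H (sliceSum (∑ i ∈ s, Y i ω))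
            (sliceSum (tlog (∫ ω, texp (Y a ω) ∂μ)))] at h
          exact h
      _ ≤ _ := by
          refine (ih (hH.add hlog)).trans_eq ?_
          rw [Finset.sum_insert ha, sliceSum_add, add_assoc]

end TProduct

theorem mainTheorem8 {Ω : Type*} [MeasurableSpace Ω] (μ : Measure Ω) [IsProbabilityMeasure μ]
    {m p : ℕ} [NeZero m] [NeZero p] {n : ℕ}
    (X : Fin n → Ω → TProduct.Tensor m m p)
    (hmeas : ∀ i, Measurable (X i))
    (hherm : ∀ i, ∀ᵐ ω ∂μ, TProduct.IsHermitian (X i ω))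
    (hindep : iIndepFun X μ)
    (b : Fin p → ℝ)
    (T : Set ℝ)
    (hTpos : ∀ t ∈ T, 0 < t)
    (hint : ∀ t ∈ T, ∀ i, Integrable (fun ω => TProduct.texp (t • X i ω)) μ)
    (htrace : ∀ t ∈ T, ∀ᵐ ω ∂μ,
      1 / (p : ℝ) * (TProduct.lambdaMax (TProduct.texp (∑ i, t • X i ω))) ^ p + 1 - 1 / (p : ℝ)
        ≤ (TProduct.ttrace (TProduct.texp (∑ i, t • X i ω))).re)
    (hb : ∀ t ∈ T, ∀ j, 0 ≤ TProduct.circExp (t • b) j) :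
    μ {ω | ∃ d : Fin p → ℝ, TProduct.IsMaxEigentuple (∑ i, X i ω) d ∧ b ≤ d} ≤
      ⨅ t ∈ T, ⨅ j : Fin p,
        ENNReal.ofReal
            (TProduct.ttrace
              (TProduct.texp (∑ i, TProduct.tlog (∫ ω, TProduct.texp (t • X i ω) ∂μ)))).re /
          ENNReal.ofReal (TProduct.circExp (t • b) j) := by
  refine le_iInf₂ fun t ht => le_iInf fun j => ?_
  have hYmeas : ∀ i, Measurable fun ω => t • X i ω := fun i => (hmeas i).const_smul t
  have hYherm : ∀ i, ∀ᵐ ω ∂μ, TProduct.IsHermitian (t • X i ω) := fun i =>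
    (hherm i).mono fun ω hω => hω.smul t
  have hYindep : iIndepFun (fun i ω => t • X i ω) μ :=
    hindep.comp (fun _ C => t • C) fun _ => measurable_const_smul t
  have hcgf : ∫⁻ ω, ENNReal.ofReal
        (TProduct.ttrace (TProduct.texp (∑ i, t • X i ω))).re ∂μ ≤
      ENNReal.ofReal (TProduct.ttrace
        (TProduct.texp (∑ i, TProduct.tlog (∫ ω, TProduct.texp (t • X i ω) ∂μ)))).re := by
    simpa only [zero_add, ← TProduct.sliceSum_texp, TProduct.trace_sliceSum] using
      TProduct.lintegral_trace_exp_add_sum_le hYmeas hYherm hYindep (hint t ht) Finset.univ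
        Matrix.isHermitian_zero
  have hlog (i : Fin n) := TProduct.isHermitian_sliceSum_tlog
    (TProduct.isHermitian_integral (hint t ht i) ((hYherm i).mono fun ω hω => hω.texp))
  have hpos : 0 < (TProduct.ttrace
      (TProduct.texp (∑ i, TProduct.tlog (∫ ω, TProduct.texp (t • X i ω) ∂μ)))).re := by
    rw [← TProduct.trace_sliceSum, TProduct.sliceSum_texp, TProduct.sliceSum_sum]
    open scoped ComplexOrder in
    exact (Complex.lt_def.1 (Matrix.IsHermitian.posDef_exp (isSelfAdjoint_sum _
      fun i _ => hlog i)).trace_pos).1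
  rcases (hb t ht j).eq_or_lt with h0 | h0
  · -- In `ENNReal`, the quotient is `⊤` only because its numerator is nonzero.
    rw [← h0, ENNReal.ofReal_zero, ENNReal.div_zero (ENNReal.ofReal_pos.2 hpos).ne']
    exact le_top
  have hf : Measurable fun ω =>
      ENNReal.ofReal (TProduct.ttrace (TProduct.texp (∑ i, t • X i ω))).re := by
    have hc : Continuous fun C : TProduct.Tensor m m p =>
        (TProduct.ttrace (TProduct.texp C)).re := by
      have := TProduct.continuous_sliceSum.comp (TProduct.continuous_texp (m := m) (p := p))
      exact Complex.continuous_re.comp this.matrix_trace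
    exact ENNReal.measurable_ofReal.comp
      (hc.measurable.comp (Finset.measurable_sum _ fun i _ => hYmeas i))
  calc _ ≤ μ {ω | ENNReal.ofReal (TProduct.circExp (t • b) j) ≤
        ENNReal.ofReal (TProduct.ttrace (TProduct.texp (∑ i, t • X i ω))).re} := by
        refine measure_mono fun ω => ?_
        rintro ⟨d, hd, hbd⟩
        refine ENNReal.ofReal_le_ofReal ?_
        rw [← Finset.smul_sum]
        exact hd.circExp_le_ttrace_texp hbd (hTpos t ht).le (hb t ht) j
    _ ≤ _ := meas_ge_le_lintegral_div hf.aemeasurable (ENNReal.ofReal_pos.2 h0).ne'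
        ENNReal.ofReal_ne_top
    _ ≤ _ := ENNReal.div_le_div_right hcgf _
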